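/- Let $n,d\ge 0$ be integers, let $\Omega\subseteq\mathbb{R}^n$ be open, and let $\delta>0$ and $\alpha>0$. Write $\|\cdot\|$ for the norm of $L^2(\Omega)^d$, and let $H^1_0(\Omega)^d$ be the closure of $C_c^\infty(\Omega)^d$ in $H^1(\Omega)^d$. Laplacians are taken in the sense of distributions. The differential (Helmholtz) filter $G$ maps $u\in L^2(\Omega)^d$ to the function $\bar u=Gu\in H^1_0(\Omega)^d$ that solves $-\delta^2\Delta\bar u+\bar u=u$ in $\Omega$. This $\bar u$ exists and is unique for every $u\in L^2(\Omega)^d$, $G$ is a bounded linear operator on $L^2(\Omega)^d$, and $(1-\alpha)G+\alpha I$ has a bounded inverse $D_\alpha=[(1-\alpha)G+\alpha I]^{-1}$ on $L^2(\Omega)^d$. Let $J\ge 0$, let $u\in L^2(\Omega)^d$, and suppose that $u$ satisfies homogeneous boundary conditions to the order needed: $u,\Delta u,\dots,\Delta^{J}u\in H^1_0(\Omega)^d$ and $\Delta^{J+1}u\in L^2(\Omega)^d$. Let $\bar u=Gu$ be the noise-free data and let $u_0,\dots,u_J\in L^2(\Omega)^d$ be the approximations of the modified iterated Tikhonov--Lavrentiev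 (Mitlar) algorithm, $$[(1-\alpha)G+\alpha I]\,u_0=\bar u,\qquad [(1-\alpha)G+\alpha I]\,(u_j-u_{j-1})=\bar u-Gu_{j-1}\quad(1\le j\le J).$$ Then the error $e_J=u-u_J$ satisfies $$e_J=(-\alpha\delta^2)^{J+1}(D_\alpha G)^{J+1}(\Delta^{J+1}u)\qquad\text{and}\qquad \|e_J\|\le(\alpha\delta^2)^{J+1}\,\|\Delta^{J+1}u\|.$$ -/

import Mathlib

open MeasureTheory TopologicalSpace
open scoped ENNReal Distributions InnerProductSpace

noncomputable section

namespace Mitlar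

variable {n d : ℕ}

/-- The Hilbert space `L²(Ω)^d` of square integrable vector fields `Ω → ℝ^d`, `Ω ⊆ ℝⁿ` open. -/
abbrev L2 (Ω : Opens (EuclideanSpace ℝ (Fin n))) (d : ℕ) : Type :=
  Lp (EuclideanSpace ℝ (Fin d)) 2 (volume.restrict (Ω : Set (EuclideanSpace ℝ (Fin n))))

/-- The classical partial derivative `∂ᵢ φ`. -/
def partialDeriv {F : Type*} [NormedAddCommGroup F] [NormedSpace ℝ F] (i : Fin n)
    (φ : EuclideanSpace ℝ (Fin n) → F) (x : EuclideanSpace ℝ (Fin n)) : F :=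
  fderiv ℝ φ x (EuclideanSpace.single i 1)

/-- `g = (g₁, …, gₙ)` is the weak gradient of `v` on `Ω`:
`∫_Ω (∂ᵢ φ) v = - ∫_Ω φ gᵢ` for every `i` and every `φ ∈ C_c^∞(Ω)`. -/
def HasWeakGradient {Ω : Opens (EuclideanSpace ℝ (Fin n))} (v : L2 Ω d)
    (g : Fin n → L2 Ω d) : Prop :=
  ∀ (i : Fin n) (φ : 𝓓(Ω, ℝ)),
    ∫ x in (Ω : Set (EuclideanSpace ℝ (Fin n))), partialDeriv i φ x • v x =
      -∫ x in (Ω : Set (EuclideanSpace ℝ (Fin n))), φ x • g i x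

/-- `v ∈ H¹₀(Ω)^d`: `v` has a square integrable weak gradient and is a limit, in the `H¹` norm,
of smooth vector fields with compact support in `Ω`. -/
def MemH10 {Ω : Opens (EuclideanSpace ℝ (Fin n))} (v : L2 Ω d) : Prop :=
  ∃ g : Fin n → L2 Ω d, HasWeakGradient v g ∧
    ∀ ε : ℝ≥0∞, 0 < ε → ∃ φ : 𝓓(Ω, EuclideanSpace ℝ (Fin d)),
      eLpNorm (fun x => v x - φ x) 2
          (volume.restrict (Ω : Set (EuclideanSpace ℝ (Fin n)))) < ε ∧
      ∀ i : Fin n, eLpNorm (fun x => g i x - partialDeriv i φ x) 2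
          (volume.restrict (Ω : Set (EuclideanSpace ℝ (Fin n)))) < ε

/-- `Δ v = w` in `Ω` in the sense of distributions:
`∫_Ω (Δ φ) v = ∫_Ω φ w` for every `φ ∈ C_c^∞(Ω)`. -/
def HasWeakLaplacian {Ω : Opens (EuclideanSpace ℝ (Fin n))} (v w : L2 Ω d) : Prop :=
  ∀ φ : 𝓓(Ω, ℝ),
    ∫ x in (Ω : Set (EuclideanSpace ℝ (Fin n))),
        (Laplacian.laplacian (φ : EuclideanSpace ℝ (Fin n) → ℝ) x) • v x =
      ∫ x in (Ω : Set (EuclideanSpace ℝ (Fin n))), φ x • w x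

/-- `w = Δᵏ v`, with homogeneous boundary data: `v, Δ v, …, Δᵏ⁻¹ v` all lie in `H¹₀(Ω)^d`
and each Laplacian up to `w = Δᵏ v` lies in `L²(Ω)^d`. -/
def HasIteratedLaplacian {Ω : Opens (EuclideanSpace ℝ (Fin n))} :
    ℕ → L2 Ω d → L2 Ω d → Prop
  | 0, v, w => w = v
  | k + 1, v, w => ∃ z : L2 Ω d, HasIteratedLaplacian k v z ∧ MemH10 z ∧ HasWeakLaplacian z w

/-- `ubar` is the filtered field of `u` with filter radius `δ`:
`ubar ∈ H¹₀(Ω)^d` and `-δ² Δ ubar + ubar = u` in `Ω`. -/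
def IsFiltered {Ω : Opens (EuclideanSpace ℝ (Fin n))} (δ : ℝ) (u ubar : L2 Ω d) : Prop :=
  MemH10 ubar ∧ ∃ w : L2 Ω d, HasWeakLaplacian ubar w ∧ -δ ^ 2 • w + ubar = u

open Classical in
/-- The differential filter `G : L²(Ω)^d → L²(Ω)^d`, `G u = ubar`: the bounded operator that sends
each `u` to its filtered field. (That it exists, so that the default value `0` is not used, and
that it is the only such map, is part of the theorem.) -/
def differentialFilter (Ω : Opens (EuclideanSpace ℝ (Fin n))) (d : ℕ) (δ : ℝ) :
    L2 Ω d →L[ℝ] L2 Ω d :=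
  if h : ∃ G : L2 Ω d →L[ℝ] L2 Ω d, ∀ u, IsFiltered δ u (G u) then h.choose else 0

/-- The operator `(1 - α) G + α I`. -/
def regularizedFilter (Ω : Opens (EuclideanSpace ℝ (Fin n))) (d : ℕ) (δ α : ℝ) :
    L2 Ω d →L[ℝ] L2 Ω d :=
  (1 - α) • differentialFilter Ω d δ + α • (1 : L2 Ω d →L[ℝ] L2 Ω d)

/-- `D_α = [(1 - α) G + α I]⁻¹`, inverse in the algebra of bounded operators on `L²(Ω)^d`. -/
def modifiedLavrentiev (Ω : Opens (EuclideanSpace ℝ (Fin n))) (d : ℕ) (δ α : ℝ) :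
    L2 Ω d →L[ℝ] L2 Ω d :=
  Ring.inverse (regularizedFilter Ω d δ α)

/-- `u₀, …, u_J` are the Mitlar approximations computed from the data `ubar`. -/
def IsMitlar {Ω : Opens (EuclideanSpace ℝ (Fin n))} (δ α : ℝ) (ubar : L2 Ω d) (J : ℕ)
    (us : ℕ → L2 Ω d) : Prop :=
  regularizedFilter Ω d δ α (us 0) = ubar ∧
    ∀ j < J, regularizedFilter Ω d δ α (us (j + 1) - us j) =
      ubar - differentialFilter Ω d δ (us j)

end Mitlar

end

open MeasureTheory TopologicalSpace Filter
open scoped ENNReal Distributions InnerProductSpace Topology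

noncomputable section

namespace Mitlar

/-! ### Operators `G` with `‖G x‖² ≤ ⟪G x, x⟫` -/

section Abstract

variable {H : Type*} [NormedAddCommGroup H] [InnerProductSpace ℝ H]

/-! Write A = (1 - α) G + α I. Since A x - G x = α (x - G x), each Mitlar step multiplies the error
by α A⁻¹ (I - G), and u₀ counts as a step with previous error u (`mitlar_error_eq_pow`). On H¹₀
fields with an L² Laplacian, I - G = -δ² G Δ (`sub_differentialFilter`), because such a v is itself
the filtered field of v - δ² Δ v. As G commutes with A⁻¹, the J + 1 factors can be traded one by one
for Laplacians of u (`pow_error_apply`).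

The analytic input is the single inequality ‖G x‖² ≤ ⟪G x, x⟫, which yields both the invertibility
of A and ‖A⁻¹ G‖ ≤ 1, hence the bound. It holds because G is the field component of the orthogonal
projection of (u, 0) onto the closure of the graph φ ↦ (φ, δ ∇ φ); this projection also proves
existence of the filter. Uniqueness follows from the dissipativity of the Dirichlet Laplacian. -/

/-- If `‖G x‖² ≤ ⟪G x, x⟫`, then `(1 - α) G + α I` is coercive with constant `min 1 α`. -/
theorem min_mul_norm_sq_le_inner {G : H →L[ℝ] H} (hG : ∀ x, ‖G x‖ ^ 2 ≤ ⟪G x, x⟫_ℝ) {α : ℝ}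
    (x : H) :
    ‖x‖ ^ 2 * min 1 α ≤ ⟪((1 - α) • G + α • (1 : H →L[ℝ] H)) x, x⟫_ℝ := by
  have h1 := hG x
  have h2 : ⟪G x, x⟫_ℝ ≤ ‖G x‖ * ‖x‖ := real_inner_le_norm _ _
  have h3 : 0 ≤ ⟪G x, x⟫_ℝ := (sq_nonneg _).trans h1
  have h4 : ⟪G x, x⟫_ℝ ≤ ‖x‖ ^ 2 := by nlinarith [sq_nonneg (‖G x‖ - ‖x‖)]
  have h5 : ⟪((1 - α) • G + α • (1 : H →L[ℝ] H)) x, x⟫_ℝ =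
      (1 - α) * ⟪G x, x⟫_ℝ + α * ‖x‖ ^ 2 := by
    simp [inner_add_left, real_inner_smul_left]
  rw [h5]
  -- The coefficient 1 - α changes sign at α = 1: above it the bound ⟪G x, x⟫ ≤ ‖x‖² is needed,
  -- below it ⟪G x, x⟫ ≥ 0.
  rcases le_total 1 α with h | h
  · rw [min_eq_left h]; nlinarith
  · rw [min_eq_right h]; nlinarith

/-- Lax–Milgram: coercivity suffices, without self-adjointness of `G`. -/
theorem isUnit_lavrentiev [CompleteSpace H] {G : H →L[ℝ] H}
    (hG : ∀ x, ‖G x‖ ^ 2 ≤ ⟪G x, x⟫_ℝ) {α : ℝ} (hα : 0 < α) :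
    IsUnit ((1 - α) • G + α • (1 : H →L[ℝ] H)) := by
  have hc : 0 < min 1 α := lt_min one_pos hα
  refine ContinuousLinearMap.isUnit_of_forall_le_norm_inner_map _ (c := ⟨min 1 α, hc.le⟩) hc
    fun x => ?_
  exact (min_mul_norm_sq_le_inner hG x).trans (Real.le_norm_self _)

/-- The hypothesis says ⟪G x, x - G x⟫ ≥ 0, so adding α (x - G x) to G x cannot shorten it. -/
theorem norm_le_norm_lavrentiev {G : H →L[ℝ] H} (hG : ∀ x, ‖G x‖ ^ 2 ≤ ⟪G x, x⟫_ℝ) {α : ℝ}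
    (hα : 0 < α) (x : H) : ‖G x‖ ≤ ‖((1 - α) • G + α • (1 : H →L[ℝ] H)) x‖ := by
  have h1 : ((1 - α) • G + α • (1 : H →L[ℝ] H)) x = G x + α • (x - G x) := by
    simp only [add_apply, smul_apply, one_apply_eq_self]
    module
  have h2 : 0 ≤ ⟪G x, x - G x⟫_ℝ := by
    rw [inner_sub_right, real_inner_self_eq_norm_sq]; linarith [hG x]
  rw [h1]
  refine le_of_sq_le_sq ?_ (norm_nonneg _)
  rw [norm_add_sq_real, real_inner_smul_right]
  nlinarith [mul_nonneg hα.le h2, sq_nonneg ‖α • (x - G x)‖]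

/-- `G` commutes with the inverse of `(1 - α) G + α I`. -/
theorem commute_inverse_lavrentiev {G : H →L[ℝ] H} {α : ℝ}
    (hA : IsUnit ((1 - α) • G + α • (1 : H →L[ℝ] H))) :
    Commute (Ring.inverse ((1 - α) • G + α • (1 : H →L[ℝ] H))) G := by
  have h : Commute ((1 - α) • G + α • (1 : H →L[ℝ] H)) G :=
    ((Commute.refl G).smul_left _).add_left ((Commute.one_left G).smul_left _)
  obtain ⟨A, hA⟩ := hA
  rw [← hA] at h ⊢
  rw [Ring.inverse_unit]
  exact h.units_inv_left

theorem norm_inverse_lavrentiev_mul_le [CompleteSpace H] {G : H →L[ℝ] H}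
    (hG : ∀ x, ‖G x‖ ^ 2 ≤ ⟪G x, x⟫_ℝ) {α : ℝ} (hα : 0 < α) :
    ‖Ring.inverse ((1 - α) • G + α • (1 : H →L[ℝ] H)) * G‖ ≤ 1 := by
  have hA := isUnit_lavrentiev hG hα
  refine ContinuousLinearMap.opNorm_le_bound _ zero_le_one fun x => ?_
  rw [(commute_inverse_lavrentiev hA).eq, one_mul]
  refine (norm_le_norm_lavrentiev hG hα _).trans_eq ?_
  exact congrArg norm (DFunLike.congr_fun (Ring.mul_inverse_cancel _ hA) x)

/-- Each Mitlar step multiplies the error by `α [(1 - α) G + α I]⁻¹ (I - G)`. -/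
theorem mitlar_error_eq_pow {G : H →L[ℝ] H} {α : ℝ}
    (hA : IsUnit ((1 - α) • G + α • (1 : H →L[ℝ] H))) {u : H} {us : ℕ → H}
    (h0 : ((1 - α) • G + α • (1 : H →L[ℝ] H)) (us 0) = G u) {J : ℕ}
    (hstep : ∀ j < J, ((1 - α) • G + α • (1 : H →L[ℝ] H)) (us (j + 1) - us j) =
      G u - G (us j)) :
    u - us J =
      ((α • (Ring.inverse ((1 - α) • G + α • (1 : H →L[ℝ] H)) * (1 - G))) ^ (J + 1)) u := by
  set A := (1 - α) • G + α • (1 : H →L[ℝ] H) with hAdef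
  have hDA : ∀ x, Ring.inverse A (A x) = x := fun x =>
    DFunLike.congr_fun (Ring.inverse_mul_cancel _ hA) x
  -- One step in general form: y is the correction computed for the field x. It serves with x = u
  -- for the start and with x the previous error afterwards.
  have hE : ∀ x y, A y = G x → x - y = (α • (Ring.inverse A * (1 - G))) x := by
    intro x y h
    have h1 : α • (x - G x) = A (x - y) := by
      rw [map_sub, h, hAdef]
      simp only [add_apply, smul_apply, one_apply_eq_self]
      module
    rw [← hDA (x - y), ← h1, map_smul]
    rfl
  induction J with
  | zero => rw [zero_add, pow_one]; exact hE u (us 0) h0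
  | succ J ih =>
    have ih := ih fun j hj => hstep j (hj.trans J.lt_succ_self)
    have h1 := hE (u - us J) (us (J + 1) - us J) (by rw [hstep J J.lt_succ_self, map_sub])
    rw [sub_sub_sub_cancel_right] at h1
    rw [h1, ih, pow_succ' _ (J + 1)]
    rfl

end Abstract

/-! ### Test functions and their classes in `L²(Ω)^d` -/

section TestFunctions

variable {n d : ℕ} {Ω : Opens (EuclideanSpace ℝ (Fin n))}
variable {F W : Type*} [NormedAddCommGroup F] [NormedSpace ℝ F]
  [NormedAddCommGroup W] [NormedSpace ℝ W]

/-- The partial derivative `∂ᵢ φ` of a test function, as a test function. -/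
def partialTest (i : Fin n) : 𝓓(Ω, F) →L[ℝ] 𝓓(Ω, F) :=
  TestFunction.lineDerivCLM ℝ (EuclideanSpace.single i 1)

theorem differentiable_test (φ : 𝓓(Ω, F)) : Differentiable ℝ φ :=
  φ.contDiff.differentiable (by simp)

theorem coe_partialTest (i : Fin n) (φ : 𝓓(Ω, F)) : ⇑(partialTest i φ) = partialDeriv i φ := by
  ext x
  rw [partialTest, TestFunction.lineDerivCLM_apply_of_le (by simp), partialDeriv,
    ((differentiable_test φ) x).lineDeriv_eq_fderiv]

theorem partialTest_postcomp (i : Fin n) (T : F →L[ℝ] W) (φ : 𝓓(Ω, F)) :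
    partialTest i (TestFunction.postcompCLM T φ) = TestFunction.postcompCLM T (partialTest i φ) := by
  ext x
  rw [TestFunction.postcompCLM_apply, Function.comp_apply, coe_partialTest, coe_partialTest,
    TestFunction.postcompCLM_apply, partialDeriv, partialDeriv,
    (T.hasFDerivAt.comp x ((differentiable_test φ) x).hasFDerivAt).fderiv]
  rfl

/-- The Laplacian `Δ φ = ∑ᵢ ∂ᵢ ∂ᵢ φ` of a test function, as a test function. -/
def laplacianTest (φ : 𝓓(Ω, F)) : 𝓓(Ω, F) := ∑ i, partialTest i (partialTest i φ)

theorem laplacianTest_postcomp (T : F →L[ℝ] W) (φ : 𝓓(Ω, F)) :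
    laplacianTest (TestFunction.postcompCLM T φ) =
      TestFunction.postcompCLM T (laplacianTest φ) := by
  simp [laplacianTest, partialTest_postcomp]

theorem coe_laplacianTest (φ : 𝓓(Ω, F)) :
    ⇑(laplacianTest φ) = Laplacian.laplacian (φ : EuclideanSpace ℝ (Fin n) → F) := by
  rw [InnerProductSpace.laplacian_eq_iteratedFDeriv_orthonormalBasis _
    (EuclideanSpace.basisFun (Fin n) ℝ)]
  ext x
  have hsum : laplacianTest φ x = ∑ i, partialTest i (partialTest i φ) x := by
    simp [laplacianTest]
  rw [hsum]
  refine Finset.sum_congr rfl fun i _ => ?_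
  have hd : DifferentiableAt ℝ (fderiv ℝ φ) x :=
    ((φ.contDiff.fderiv_right (m := 1) (by norm_cast)).differentiable (by simp)) x
  rw [coe_partialTest, partialDeriv, coe_partialTest, iteratedFDeriv_two_apply]
  have : (partialDeriv i φ) = fun y => fderiv ℝ φ y (EuclideanSpace.single i 1) := rfl
  rw [this, fderiv_clm_apply hd (differentiableAt_const _)]
  simp

theorem memLp_test (φ : 𝓓(Ω, F)) (p : ℝ≥0∞) :
    MemLp φ p (volume.restrict (Ω : Set (EuclideanSpace ℝ (Fin n)))) :=
  (φ.continuous.memLp_of_hasCompactSupport φ.hasCompactSupport).restrict _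

/-- The class in `L²(Ω)^d` of a test function. -/
def toL2 : 𝓓(Ω, EuclideanSpace ℝ (Fin d)) →ₗ[ℝ] L2 Ω d where
  toFun φ := (memLp_test φ 2).toLp φ
  map_add' _ _ := rfl
  map_smul' _ _ := rfl

theorem coeFn_toL2 (φ : 𝓓(Ω, EuclideanSpace ℝ (Fin d))) :
    toL2 φ =ᵐ[volume.restrict (Ω : Set (EuclideanSpace ℝ (Fin n)))] φ :=
  (memLp_test φ 2).coeFn_toLp

theorem inner_toL2 (φ : 𝓓(Ω, EuclideanSpace ℝ (Fin d))) (v : L2 Ω d) :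
    ⟪toL2 φ, v⟫_ℝ = ∫ x in (Ω : Set (EuclideanSpace ℝ (Fin n))), ⟪φ x, v x⟫_ℝ := by
  rw [L2.inner_def]
  refine integral_congr_ae ?_
  filter_upwards [coeFn_toL2 φ] with x hx
  rw [hx]

/-- The vector valued test function `φ e`. -/
def tensorTest (φ : 𝓓(Ω, ℝ)) (e : F) : 𝓓(Ω, F) :=
  TestFunction.postcompCLM (ContinuousLinearMap.toSpanSingleton ℝ e) φ

theorem tensorTest_apply (φ : 𝓓(Ω, ℝ)) (e : F) (x : EuclideanSpace ℝ (Fin n)) :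
    tensorTest φ e x = φ x • e := rfl

theorem sum_tensorTest (ψ : 𝓓(Ω, EuclideanSpace ℝ (Fin d))) :
    ∑ k, tensorTest (TestFunction.postcompCLM (EuclideanSpace.proj k : _ →L[ℝ] ℝ) ψ)
      (EuclideanSpace.single k (1 : ℝ)) = ψ := by
  ext x j
  have : (∑ k, tensorTest (TestFunction.postcompCLM (EuclideanSpace.proj k : _ →L[ℝ] ℝ) ψ)
      (EuclideanSpace.single k (1 : ℝ))) x = ∑ k, ψ x k • EuclideanSpace.single k (1 : ℝ) := by
    simp [tensorTest_apply]
  rw [this]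
  simp [Finset.sum_apply, Pi.single_apply]

theorem inner_integral_smul (φ : 𝓓(Ω, ℝ)) (v : L2 Ω d) (e : EuclideanSpace ℝ (Fin d)) :
    ⟪e, ∫ x in (Ω : Set (EuclideanSpace ℝ (Fin n))), φ x • v x⟫_ℝ =
      ⟪toL2 (tensorTest φ e), v⟫_ℝ := by
  have hint : Integrable (fun x => φ x • v x)
      (volume.restrict (Ω : Set (EuclideanSpace ℝ (Fin n)))) :=
    memLp_one_iff_integrable.1 ((Lp.memLp v).smul (memLp_test φ 2))
  rw [inner_toL2, ← integral_inner hint]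
  refine integral_congr_ae (Eventually.of_forall fun x => ?_)
  simp only [tensorTest_apply, real_inner_smul_left, real_inner_smul_right]

/-- Vector valued identities against scalar test functions are scalar identities against
vector valued test functions. -/
theorem integral_smul_eq_iff {φ ψ : 𝓓(Ω, ℝ)} {v w : L2 Ω d} :
    ∫ x in (Ω : Set (EuclideanSpace ℝ (Fin n))), φ x • v x =
      ∫ x in (Ω : Set (EuclideanSpace ℝ (Fin n))), ψ x • w x ↔
    ∀ e, ⟪toL2 (tensorTest φ e), v⟫_ℝ = ⟪toL2 (tensorTest ψ e), w⟫_ℝ := by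
  simp only [← inner_integral_smul]
  exact ⟨fun h e => by rw [h], fun h => ext_inner_left ℝ h⟩

/-- Splitting a vector test function into components turns the distributional identity into one
between L² inner products, which pass to limits. -/
theorem hasWeakLaplacian_iff {v w : L2 Ω d} :
    HasWeakLaplacian v w ↔ ∀ ψ : 𝓓(Ω, EuclideanSpace ℝ (Fin d)),
      ⟪toL2 (laplacianTest ψ), v⟫_ℝ = ⟪toL2 ψ, w⟫_ℝ := by
  have key : HasWeakLaplacian v w ↔ ∀ (φ : 𝓓(Ω, ℝ)) (e : EuclideanSpace ℝ (Fin d)),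
      ⟪toL2 (laplacianTest (tensorTest φ e)), v⟫_ℝ = ⟪toL2 (tensorTest φ e), w⟫_ℝ := by
    refine forall_congr' fun φ => ?_
    rw [← coe_laplacianTest, integral_smul_eq_iff]
    simp only [tensorTest, laplacianTest_postcomp]
  rw [key]
  refine ⟨fun h ψ => ?_, fun h φ e => h _⟩
  have hsum : laplacianTest ψ = ∑ k, laplacianTest
      (tensorTest (TestFunction.postcompCLM (EuclideanSpace.proj k : _ →L[ℝ] ℝ) ψ)
        (EuclideanSpace.single k (1 : ℝ))) := by
    conv_lhs => rw [← sum_tensorTest ψ]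
    simp only [laplacianTest, map_sum]
    exact Finset.sum_comm
  rw [hsum]
  conv_rhs => rw [← sum_tensorTest ψ]
  simp only [map_sum, sum_inner, h]

theorem hasWeakGradient_iff {v : L2 Ω d} {g : Fin n → L2 Ω d} :
    HasWeakGradient v g ↔ ∀ (i : Fin n) (ψ : 𝓓(Ω, EuclideanSpace ℝ (Fin d))),
      ⟪toL2 (partialTest i ψ), v⟫_ℝ = -⟪toL2 ψ, g i⟫_ℝ := by
  have key : HasWeakGradient v g ↔ ∀ (i : Fin n) (φ : 𝓓(Ω, ℝ)) (e : EuclideanSpace ℝ (Fin d)),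
      ⟪toL2 (partialTest i (tensorTest φ e)), v⟫_ℝ = -⟪toL2 (tensorTest φ e), g i⟫_ℝ := by
    refine forall_congr' fun i => forall_congr' fun φ => ?_
    rw [← coe_partialTest]
    simp only [tensorTest, partialTest_postcomp]
    refine ⟨fun h e => ?_, fun h => ext_inner_left ℝ fun e => ?_⟩
    · have := congrArg (fun y => ⟪e, y⟫_ℝ) h
      simpa only [inner_neg_right, inner_integral_smul, tensorTest] using this
    · rw [inner_neg_right, inner_integral_smul, inner_integral_smul]
      exact h e
  rw [key]
  refine ⟨fun h i ψ => ?_, fun h i φ e => h _ _⟩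
  rw [← sum_tensorTest ψ]
  simp only [map_sum, sum_inner, h, Finset.sum_neg_distrib]

/-- Lets integration by parts take place on the whole space, with no boundary of Ω in sight. -/
theorem setIntegral_test_eq {f : EuclideanSpace ℝ (Fin n) → ℝ} {φ : 𝓓(Ω, F)}
    (hf : ∀ x, φ x = 0 → f x = 0) :
    ∫ x in (Ω : Set (EuclideanSpace ℝ (Fin n))), f x = ∫ x, f x := by
  refine setIntegral_eq_integral_of_forall_compl_eq_zero fun x hx => hf x ?_
  by_contra h
  exact hx (φ.tsupport_subset (subset_tsupport _ h))

/-- Integration by parts for test functions. -/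
theorem inner_toL2_partialTest (i : Fin n) (φ ψ : 𝓓(Ω, EuclideanSpace ℝ (Fin d))) :
    ⟪toL2 (partialTest i φ), toL2 ψ⟫_ℝ = -⟪toL2 φ, toL2 (partialTest i ψ)⟫_ℝ := by
  have hi : ∀ a b : 𝓓(Ω, EuclideanSpace ℝ (Fin d)), Integrable (fun x => innerSL ℝ (a x) (b x)) :=
    fun a b => (by fun_prop : Continuous fun x => innerSL ℝ (a x) (b x)).integrable_of_hasCompactSupport
      (a.hasCompactSupport.mono fun x hx h => hx (by simp [h]))
  have hc : ∀ a b : 𝓓(Ω, EuclideanSpace ℝ (Fin d)),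
      ⟪toL2 a, toL2 b⟫_ℝ = ∫ x, innerSL ℝ (a x) (b x) := by
    intro a b
    rw [inner_toL2, ← setIntegral_test_eq (φ := a) (by intro x hx; simp [hx])]
    refine integral_congr_ae ?_
    filter_upwards [coeFn_toL2 b] with x hx
    rw [hx]; rfl
  have h1 := hi φ (partialTest i ψ)
  have h2 := hi (partialTest i φ) ψ
  rw [hc, hc]
  rw [coe_partialTest] at h1 h2 ⊢
  rw [coe_partialTest]
  rw [eq_neg_iff_add_eq_zero, add_comm, ← eq_neg_iff_add_eq_zero]
  exact integral_bilinear_fderiv_right_eq_neg_left_of_integrable (B := innerSL ℝ)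
    h2 h1 (hi φ ψ) (fun x _ => differentiable_test φ x) (fun x _ => differentiable_test ψ x)

end TestFunctions

/-! ### The space `H¹₀(Ω)^d` -/

section Sobolev

variable {n d : ℕ} {Ω : Opens (EuclideanSpace ℝ (Fin n))}

theorem edist_toL2 (v : L2 Ω d) (φ : 𝓓(Ω, EuclideanSpace ℝ (Fin d))) :
    edist (toL2 φ) v = eLpNorm (fun x => v x - φ x) 2
      (volume.restrict (Ω : Set (EuclideanSpace ℝ (Fin n)))) := by
  rw [edist_comm, Lp.edist_def]
  refine eLpNorm_congr_ae ?_
  filter_upwards [coeFn_toL2 φ] with x hx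
  simp [hx]

/-- `φₘ → v` in `H¹`, where `g` is the gradient of `v`. -/
def TendstoH1 (φ : ℕ → 𝓓(Ω, EuclideanSpace ℝ (Fin d))) (v : L2 Ω d) (g : Fin n → L2 Ω d) : Prop :=
  Tendsto (fun m => toL2 (φ m)) atTop (𝓝 v) ∧
    ∀ i, Tendsto (fun m => toL2 (partialTest i (φ m))) atTop (𝓝 (g i))

/-- Weak gradients come for free with `H¹` limits of test functions. -/
theorem TendstoH1.hasWeakGradient {φ : ℕ → 𝓓(Ω, EuclideanSpace ℝ (Fin d))} {v : L2 Ω d}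
    {g : Fin n → L2 Ω d} (h : TendstoH1 φ v g) : HasWeakGradient v g := by
  refine hasWeakGradient_iff.2 fun i ψ => ?_
  have h1 : Tendsto (fun m => ⟪toL2 (partialTest i ψ), toL2 (φ m)⟫_ℝ) atTop
      (𝓝 ⟪toL2 (partialTest i ψ), v⟫_ℝ) := tendsto_const_nhds.inner h.1
  have h2 : Tendsto (fun m => -⟪toL2 ψ, toL2 (partialTest i (φ m))⟫_ℝ) atTop
      (𝓝 (-⟪toL2 ψ, g i⟫_ℝ)) := (tendsto_const_nhds.inner (h.2 i)).neg
  simp only [inner_toL2_partialTest] at h1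
  exact tendsto_nhds_unique h1 h2

theorem memH10_iff {v : L2 Ω d} : MemH10 v ↔ ∃ g φ, TendstoH1 φ v g := by
  simp only [MemH10, ← coe_partialTest, ← edist_toL2]
  constructor
  · rintro ⟨g, -, h⟩
    -- At m = 0 the tolerance is ∞, which is harmless.
    have hpos : ∀ m : ℕ, (0 : ℝ≥0∞) < (m : ℝ≥0∞)⁻¹ := fun m =>
      ENNReal.inv_pos.2 (ENNReal.natCast_ne_top m)
    choose φ h1 h2 using fun m : ℕ => h _ (hpos m)
    refine ⟨g, φ, ?_, fun i => ?_⟩ <;> rw [tendsto_iff_edist_tendsto_0]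
    · exact tendsto_of_tendsto_of_tendsto_of_le_of_le tendsto_const_nhds
        ENNReal.tendsto_inv_nat_nhds_zero (fun _ => zero_le) fun m => (h1 m).le
    · exact tendsto_of_tendsto_of_tendsto_of_le_of_le tendsto_const_nhds
        ENNReal.tendsto_inv_nat_nhds_zero (fun _ => zero_le) fun m => (h2 m i).le
  · rintro ⟨g, φ, h⟩
    refine ⟨g, h.hasWeakGradient, fun ε hε => ?_⟩
    have h1 := (tendsto_iff_edist_tendsto_0.1 h.1).eventually_lt_const hε
    have h2 : ∀ᶠ m in atTop, ∀ i, edist (toL2 (partialTest i (φ m))) (g i) < ε :=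
      eventually_all.2 fun i => (tendsto_iff_edist_tendsto_0.1 (h.2 i)).eventually_lt_const hε
    obtain ⟨m, h1, h2⟩ := (h1.and h2).exists
    exact ⟨φ m, h1, h2⟩

theorem MemH10.sub {v v' : L2 Ω d} (h : MemH10 v) (h' : MemH10 v') : MemH10 (v - v') := by
  obtain ⟨g, φ, h⟩ := memH10_iff.1 h
  obtain ⟨g', φ', h'⟩ := memH10_iff.1 h'
  refine memH10_iff.2 ⟨g - g', φ - φ', ?_, fun i => ?_⟩
  · simpa using h.1.sub h'.1
  · simpa using (h.2 i).sub (h'.2 i)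

theorem HasWeakLaplacian.sub {v v' w w' : L2 Ω d} (h : HasWeakLaplacian v w)
    (hv' : HasWeakLaplacian v' w') : HasWeakLaplacian (v - v') (w - w') := by
  rw [hasWeakLaplacian_iff] at *
  intro ψ
  simp only [hv', h, inner_sub_right]

/-- Testing against the second derivatives amounts to testing the weak gradient. -/
theorem HasWeakGradient.inner_laplacianTest {v : L2 Ω d} {g : Fin n → L2 Ω d}
    (h : HasWeakGradient v g) (ψ : 𝓓(Ω, EuclideanSpace ℝ (Fin d))) :
    ⟪toL2 (laplacianTest ψ), v⟫_ℝ = -∑ i, ⟪toL2 (partialTest i ψ), g i⟫_ℝ := by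
  rw [hasWeakGradient_iff] at h
  simp only [laplacianTest, map_sum, sum_inner, h, Finset.sum_neg_distrib]

/-- The Dirichlet Laplacian is dissipative. -/
theorem inner_weakLaplacian_nonpos {v w : L2 Ω d} (hv : MemH10 v) (hw : HasWeakLaplacian v w) :
    ⟪v, w⟫_ℝ ≤ 0 := by
  obtain ⟨g, φ, h⟩ := memH10_iff.1 hv
  have h1 : Tendsto (fun m => ⟪toL2 (φ m), w⟫_ℝ) atTop (𝓝 ⟪v, w⟫_ℝ) :=
    h.1.inner tendsto_const_nhds
  have h2 : Tendsto (fun m => -∑ i, ⟪toL2 (partialTest i (φ m)), g i⟫_ℝ) atTop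
      (𝓝 (-∑ i, ⟪g i, g i⟫_ℝ)) :=
    (tendsto_finsetSum _ fun i _ => (h.2 i).inner tendsto_const_nhds).neg
  -- Both sequences are now ⟪φₘ, w⟫, so in the limit ⟪v, w⟫ = -∑ᵢ ‖gᵢ‖².
  simp only [← h.hasWeakGradient.inner_laplacianTest, hasWeakLaplacian_iff.1 hw] at h2
  rw [tendsto_nhds_unique h1 h2]
  exact neg_nonpos.2 (Finset.sum_nonneg fun i _ => real_inner_self_nonneg)

/-- The difference satisfies v - v' = δ² Δ(v - v'), so dissipativity gives ‖v - v'‖² ≤ 0. -/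
theorem IsFiltered.unique {δ : ℝ} {u v v' : L2 Ω d} (h : IsFiltered δ u v)
    (h' : IsFiltered δ u v') : v = v' := by
  obtain ⟨hv, w, hw, hu⟩ := h
  obtain ⟨hv', w', hw', hu'⟩ := h'
  have h1 := inner_weakLaplacian_nonpos (hv.sub hv') (hw.sub hw')
  have h2 : v - v' = δ ^ 2 • (w - w') := by
    have h3 : -δ ^ 2 • w + v - (-δ ^ 2 • w' + v') = 0 := by rw [hu, hu', sub_self]
    rw [← sub_eq_zero, ← h3]
    module
  have h4 : ⟪v - v', v - v'⟫_ℝ ≤ 0 := by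
    conv_lhs => rw [h2, real_inner_smul_right, ← h2]
    exact mul_nonpos_of_nonneg_of_nonpos (sq_nonneg δ) h1
  exact sub_eq_zero.1 (inner_self_eq_zero.1 (h4.antisymm real_inner_self_nonneg))

/-! ### Existence of the filter by orthogonal projection -/

/-- The Hilbert space `L²(Ω)^d × (L²(Ω)^d)ⁿ` of pairs of a field and a gradient. -/
abbrev FieldGrad (Ω : Opens (EuclideanSpace ℝ (Fin n))) (d : ℕ) : Type :=
  PiLp 2 fun _ : Option (Fin n) => L2 Ω d

/-- The map `φ ↦ (φ, δ ∇ φ)`. -/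
def scaledGraph (Ω : Opens (EuclideanSpace ℝ (Fin n))) (d : ℕ) (δ : ℝ) :
    𝓓(Ω, EuclideanSpace ℝ (Fin d)) →ₗ[ℝ] FieldGrad Ω d where
  toFun φ := WithLp.toLp 2 fun o => o.elim (toL2 φ) fun i => δ • toL2 (partialTest i φ)
  map_add' φ ψ := by
    ext1 o
    cases o <;> simp
  map_smul' c φ := by
    ext1 o
    cases o
    · simp
    · simp [smul_comm δ c]

/-- `H¹₀(Ω)^d` as a closed subspace, through `v ↦ (v, δ ∇ v)`. -/
def sobolevGraph (Ω : Opens (EuclideanSpace ℝ (Fin n))) (d : ℕ) (δ : ℝ) :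
    Submodule ℝ (FieldGrad Ω d) :=
  (LinearMap.range (scaledGraph Ω d δ)).topologicalClosure

instance (Ω : Opens (EuclideanSpace ℝ (Fin n))) (d : ℕ) (δ : ℝ) :
    CompleteSpace (sobolevGraph Ω d δ) :=
  (Submodule.isClosed_topologicalClosure _).completeSpace_coe

theorem exists_tendstoH1_of_mem_sobolevGraph {δ : ℝ} (hδ : δ ≠ 0) {z : FieldGrad Ω d}
    (hz : z ∈ sobolevGraph Ω d δ) : ∃ φ, TendstoH1 φ (z none) fun i => δ⁻¹ • z (some i) := by
  obtain ⟨x, hx, hlim⟩ := mem_closure_iff_seq_limit.1 hz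
  choose φ hφ using hx
  have hlim' : ∀ o, Tendsto (fun m => scaledGraph Ω d δ (φ m) o) atTop (𝓝 (z o)) := fun o => by
    simp only [hφ]
    exact ((PiLp.continuous_apply 2 _ o).tendsto z).comp hlim
  refine ⟨φ, hlim' none, fun i => ?_⟩
  have h := (hlim' (some i)).const_smul δ⁻¹
  refine h.congr fun m => ?_
  exact inv_smul_smul₀ hδ _

/-- The embedding `u ↦ (u, 0)`. -/
def fieldEmb (Ω : Opens (EuclideanSpace ℝ (Fin n))) (d : ℕ) : L2 Ω d →L[ℝ] FieldGrad Ω d :=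
  (PiLp.continuousLinearEquiv 2 ℝ fun _ : Option (Fin n) => L2 Ω d).symm ∘L
    ContinuousLinearMap.single ℝ (fun _ : Option (Fin n) => L2 Ω d) none

theorem inner_fieldEmb (u : L2 Ω d) (z : FieldGrad Ω d) : ⟪fieldEmb Ω d u, z⟫_ℝ = ⟪u, z none⟫_ℝ := by
  simp [fieldEmb, PiLp.inner_apply, Fintype.sum_option]

/-- The filter: `u ↦ v`, where `(v, δ ∇ v)` is the projection of `(u, 0)` to `H¹₀(Ω)^d`. -/
def projFilter (Ω : Opens (EuclideanSpace ℝ (Fin n))) (d : ℕ) (δ : ℝ) : L2 Ω d →L[ℝ] L2 Ω d :=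
  PiLp.proj 2 (fun _ : Option (Fin n) => L2 Ω d) none ∘L
    (sobolevGraph Ω d δ).starProjection ∘L fieldEmb Ω d

theorem projFilter_apply (δ : ℝ) (u : L2 Ω d) :
    projFilter Ω d δ u = (sobolevGraph Ω d δ).starProjection (fieldEmb Ω d u) none := rfl

/-- For an orthogonal projection P, ⟪P(u, 0), (u, 0)⟫ = ‖P(u, 0)‖², which dominates the squared norm
of the field component alone. -/
theorem norm_sq_projFilter_le (δ : ℝ) (u : L2 Ω d) :
    ‖projFilter Ω d δ u‖ ^ 2 ≤ ⟪projFilter Ω d δ u, u⟫_ℝ := by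
  set z := (sobolevGraph Ω d δ).starProjection (fieldEmb Ω d u) with hz
  have h1 : ⟪projFilter Ω d δ u, u⟫_ℝ = ‖z‖ ^ 2 := by
    rw [real_inner_comm, projFilter_apply, ← inner_fieldEmb, ← hz,
      ← real_inner_self_eq_norm_sq, eq_comm, ← sub_eq_zero, ← inner_sub_left]
    rw [← neg_sub, inner_neg_left, neg_eq_zero]
    exact Submodule.inner_left_of_mem_orthogonal (Submodule.starProjection_apply_mem _ _)
      (Submodule.sub_starProjection_mem_orthogonal _)
  rw [h1, projFilter_apply, ← hz]
  gcongr
  exact PiLp.norm_apply_le z none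

theorem isFiltered_projFilter {δ : ℝ} (hδ : 0 < δ) (u : L2 Ω d) :
    IsFiltered δ u (projFilter Ω d δ u) := by
  set z := (sobolevGraph Ω d δ).starProjection (fieldEmb Ω d u) with hz
  obtain ⟨φ, hφ⟩ := exists_tendstoH1_of_mem_sobolevGraph hδ.ne'
    (Submodule.starProjection_apply_mem (sobolevGraph Ω d δ) (fieldEmb Ω d u))
  rw [← hz] at hφ
  have hv : projFilter Ω d δ u = z none := rfl
  rw [hv]
  -- The Laplacian is read off from -δ² Δ v + v = u.
  refine ⟨memH10_iff.2 ⟨_, φ, hφ⟩, (δ ^ 2)⁻¹ • (z none - u), hasWeakLaplacian_iff.2 fun ψ => ?_, ?_⟩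
  -- Orthogonality of (u, 0) - z to (ψ, δ ∇ ψ) is the weak equation ⟪u - v, ψ⟫ = δ² ∑ᵢ ⟪gᵢ, ∂ᵢ ψ⟫,
  -- where z = (v, δ g).
  · have horth : ⟪fieldEmb Ω d u - z, scaledGraph Ω d δ ψ⟫_ℝ = 0 :=
      Submodule.inner_left_of_mem_orthogonal
        (Submodule.le_topologicalClosure _ (LinearMap.mem_range_self _ ψ))
        (Submodule.sub_starProjection_mem_orthogonal _)
    have hn : scaledGraph Ω d δ ψ none = toL2 ψ := rfl
    have hs : ∀ i, scaledGraph Ω d δ ψ (some i) = δ • toL2 (partialTest i ψ) := fun _ => rfl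
    rw [inner_sub_left, inner_fieldEmb, PiLp.inner_apply, Fintype.sum_option, hn] at horth
    simp only [hs, real_inner_smul_right, ← Finset.mul_sum] at horth
    rw [hφ.hasWeakGradient.inner_laplacianTest]
    simp only [real_inner_smul_right, inner_sub_right, ← Finset.mul_sum]
    simp only [real_inner_comm] at horth ⊢
    field_simp
    linarith
  · rw [neg_smul, smul_inv_smul₀ (pow_ne_zero 2 hδ.ne')]
    abel

theorem differentialFilter_eq_projFilter {δ : ℝ} (hδ : 0 < δ) :
    differentialFilter Ω d δ = projFilter Ω d δ := by
  have h : ∃ G : L2 Ω d →L[ℝ] L2 Ω d, ∀ u, IsFiltered δ u (G u) :=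
    ⟨_, isFiltered_projFilter hδ⟩
  rw [differentialFilter, dif_pos h]
  ext1 u
  exact (h.choose_spec u).unique (isFiltered_projFilter hδ u)

theorem isFiltered_iff {δ : ℝ} (hδ : 0 < δ) {u v : L2 Ω d} :
    IsFiltered δ u v ↔ v = differentialFilter Ω d δ u := by
  rw [differentialFilter_eq_projFilter hδ]
  exact ⟨fun h => h.unique (isFiltered_projFilter hδ u),
    fun h => h ▸ isFiltered_projFilter hδ u⟩

/-- On fields with homogeneous boundary data, `I - G = -δ² G Δ`. -/
theorem sub_differentialFilter {δ : ℝ} (hδ : 0 < δ) {v w : L2 Ω d} (hv : MemH10 v)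
    (hw : HasWeakLaplacian v w) :
    v - differentialFilter Ω d δ v = -δ ^ 2 • differentialFilter Ω d δ w := by
  have h : v = differentialFilter Ω d δ (-δ ^ 2 • w + v) :=
    (isFiltered_iff hδ).1 ⟨hv, w, hw, rfl⟩
  rw [map_add, map_smul] at h
  exact sub_eq_iff_eq_add.2 h

/-- The powers of the error operator act on `u` through the iterated Laplacian of `u`. -/
theorem pow_error_apply {δ α : ℝ} (hδ : 0 < δ) (hA : IsUnit (regularizedFilter Ω d δ α)) {k : ℕ}
    {u w : L2 Ω d} (h : HasIteratedLaplacian k u w) :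
    ((α • (modifiedLavrentiev Ω d δ α * (1 - differentialFilter Ω d δ))) ^ k) u =
      (-(α * δ ^ 2)) ^ k • ((modifiedLavrentiev Ω d δ α * differentialFilter Ω d δ) ^ k) w := by
  induction k generalizing w with
  | zero =>
    obtain rfl : w = u := h
    simp
  | succ k ih =>
    obtain ⟨z, hz, hz0, hw⟩ := h
    set D := modifiedLavrentiev Ω d δ α with hD
    set G := differentialFilter Ω d δ with hG
    have hDG : Commute D G := commute_inverse_lavrentiev hA
    -- Moves the new error factor past (D G)ᵏ so that it acts directly on z = Δᵏ u, which lies in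
    -- H¹₀.
    have hcomm : Commute (α • (D * (1 - G))) ((D * G) ^ k) := by
      refine Commute.smul_left (Commute.pow_right ?_ k) α
      refine Commute.mul_left ((Commute.refl D).mul_right hDG) ?_
      exact ((Commute.one_left D).sub_left hDG.symm).mul_right
        ((Commute.one_left G).sub_left (Commute.refl G))
    have hstep : (α • (D * (1 - G))) z = -(α * δ ^ 2) • (D * G) w := by
      have h1 : (α • (D * (1 - G))) z = α • D (z - G z) := rfl
      rw [h1, sub_differentialFilter hδ hz0 hw, map_smul, smul_smul, mul_neg]
      rfl
    have h2 : ∀ (S T : L2 Ω d →L[ℝ] L2 Ω d) (x : L2 Ω d), (S * T) x = S (T x) := fun _ _ _ => rfl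
    rw [pow_succ', h2, ih hz, map_smul, ← h2, hcomm.eq, h2, hstep, map_smul, smul_smul,
      ← pow_succ, ← h2, ← pow_succ]

end Sobolev

end Mitlar

end

theorem mainTheorem2 {n d : ℕ} (Ω : TopologicalSpace.Opens (EuclideanSpace ℝ (Fin n)))
    (δ α : ℝ) (hδ : 0 < δ) (hα : 0 < α) :
    -- the filter `G` is well defined, and `(1 - α) G + α I` is boundedly invertible
    (∀ u ubar : Mitlar.L2 Ω d,
      Mitlar.IsFiltered δ u ubar ↔ ubar = Mitlar.differentialFilter Ω d δ u) ∧
    IsUnit (Mitlar.regularizedFilter Ω d δ α) ∧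
    -- the error identity and the error bound; `w` is `Δ^(J+1) u`
    ∀ (J : ℕ) (u ubar w : Mitlar.L2 Ω d) (us : ℕ → Mitlar.L2 Ω d),
      Mitlar.differentialFilter Ω d δ u = ubar →
      Mitlar.IsMitlar δ α ubar J us →
      Mitlar.HasIteratedLaplacian (J + 1) u w →
      u - us J = (-(α * δ ^ 2)) ^ (J + 1) •
          ((Mitlar.modifiedLavrentiev Ω d δ α * Mitlar.differentialFilter Ω d δ) ^ (J + 1)) w ∧
      ‖u - us J‖ ≤ (α * δ ^ 2) ^ (J + 1) * ‖w‖ := by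
  have hG : ∀ x, ‖Mitlar.differentialFilter Ω d δ x‖ ^ 2 ≤
      inner ℝ (Mitlar.differentialFilter Ω d δ x) x := by
    rw [Mitlar.differentialFilter_eq_projFilter hδ]
    exact Mitlar.norm_sq_projFilter_le δ
  have hA : IsUnit (Mitlar.regularizedFilter Ω d δ α) := Mitlar.isUnit_lavrentiev hG hα
  refine ⟨fun u ubar => Mitlar.isFiltered_iff hδ, hA, ?_⟩
  rintro J u _ w us rfl ⟨h0, hstep⟩ hw
  have herr := (Mitlar.mitlar_error_eq_pow hA h0 hstep).trans (Mitlar.pow_error_apply hδ hA hw)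
  refine ⟨herr, ?_⟩
  have hDG : ‖Mitlar.modifiedLavrentiev Ω d δ α * Mitlar.differentialFilter Ω d δ‖ ≤ 1 :=
    Mitlar.norm_inverse_lavrentiev_mul_le hG hα
  have hpow : ‖(Mitlar.modifiedLavrentiev Ω d δ α * Mitlar.differentialFilter Ω d δ) ^ (J + 1)‖ ≤ 1 :=
    (norm_pow_le' _ J.succ_pos).trans (pow_le_one₀ (norm_nonneg _) hDG)
  rw [herr, norm_smul, norm_pow, norm_neg, Real.norm_of_nonneg (by positivity)]
  gcongr
  simpa using ContinuousLinearMap.le_of_opNorm_le _ hpow w
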